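/- Let $\Theta$ be a measurable subset of $\mathbb{R}^d$ with its Borel $\sigma$-field, let $\mathcal{H}$ be a convex compact subset of $\mathbb{R}^k$, and let $P$ be a probability measure on $\Theta$. For each $h\in\mathcal{H}$ let $f_h\colon\Theta\to\mathbb{R}$ be measurable with $\int|f_h|\,dP<\infty$. Let $\theta_1,\theta_2,\dots$ be a Markov chain on $\Theta$ (with arbitrary initial law) whose transition kernel is Harris ergodic, i.e. irreducible, aperiodic and Harris recurrent, and has $P$ as an invariant distribution. Suppose that there is a regeneration sequence for the chain, that is, integer random times $1=\tau_0<\tau_1<\tau_2<\cdots$ (almost surely) such that, for every $r$, the future from time $\tau_r$ on, namely $\bigl((\theta_{\tau_r+k})_{k\ge0},(\tau_{r+s}-\tau_r)_{s\ge0}\bigr)$, is independent of the past before $\tau_r$ (the first $r$ tours, with their lengths) and has the same law as $\bigl((\theta_{1+k})_{k\ge0},(\tau_s-\tau_0)_{s\ge0}\bigr)$; and suppose that $E(\tau_1-\tau_0)<\infty$. Put $$S_r^{(h)}=\sum_{i=\tau_{r-1}}^{\tau_r-1}f_h(\theta_i),\qquad r=1,2,\dots$$ Suppose that for $P$-almost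 every $\theta$ the map $h\mapsto f_h(\theta)$ is continuous on $\mathcal{H}$, and that $\sup_{h}|S_1^{(h)}|$ is measurable (almost everywhere measurability suffices) and satisfies $E\bigl(\sup_{h}|S_1^{(h)}|\bigr)<\infty$. Then, when the chain is run for $R$ regenerations, i.e. with $n=n_R=\sum_{r=1}^R(\tau_r-\tau_{r-1})=\tau_R-\tau_0$, $$\sup_{h\in\mathcal{H}}\left|\frac1n\sum_{i=1}^nf_h(\theta_i)-E_P\bigl(f_h(\theta)\bigr)\right|\longrightarrow0\quad\text{almost surely as } R\to\infty .$$ If, moreover, $E\Bigl(\sup_{h}\sum_{i=\tau_0}^{\tau_1-1}|f_h(\theta_i)|\Bigr)<\infty$ (which is no further assumption when all $f_h\ge0$), then the same convergence holds almost surely as $n\to\infty$ through all positive integers. -/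

import Mathlib

open MeasureTheory ProbabilityTheory Filter
open scoped ENNReal Topology

noncomputable section

namespace MarkovRegen

variable {α : Type*} [MeasurableSpace α]

/-- The transition kernel `κ` viewed as a kernel from histories `(x₀, …, xₙ)` to the next state:
only the current state `xₙ` matters. -/
def step (κ : Kernel α α) (n : ℕ) : Kernel (Finset.Iic n → α) α :=
  κ.comap (fun x => x ⟨n, Finset.mem_Iic.2 le_rfl⟩) (measurable_pi_apply _)

instance (κ : Kernel α α) [IsMarkovKernel κ] (n : ℕ) : IsMarkovKernel (step κ n) := by
  unfold step
  infer_instance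

/-- The law, on the space of trajectories, of the Markov chain with transition kernel `κ`
started at the point `x`. -/
def chainLaw (κ : Kernel α α) [IsMarkovKernel κ] (x : α) : Measure (ℕ → α) :=
  Kernel.traj (X := fun _ => α) (step κ) 0 (fun _ => x)

/-- `θ` is a (time-homogeneous) Markov chain with transition kernel `κ`: the conditional law of
`θ (n + 1)` given `(θ 0, …, θ n)` is `κ (θ n)`. The initial law is arbitrary. -/
structure IsMarkovChain {Ω : Type*} [MeasurableSpace Ω] (μ : Measure Ω) (κ : Kernel α α)
    (θ : ℕ → Ω → α) : Prop where
  measurable : ∀ n, Measurable (θ n)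
  hasCondDistrib : ∀ n,
    HasCondDistrib (θ (n + 1)) (fun ω (i : Finset.Iic n) => θ i ω) (step κ n) μ

/-- `φ` is an irreducibility measure of `κ`: it is σ-finite, nonzero, and every set of positive
`φ`-measure can be reached with positive probability from every state. -/
def IsIrreducibilityMeasure (κ : Kernel α α) (φ : Measure α) : Prop :=
  SigmaFinite φ ∧ φ ≠ 0 ∧ Kernel.IsIrreducible φ κ

/-- The measurable sets charged by some irreducibility measure; equivalently those of positive
measure for a maximal irreducibility measure `ψ`. -/
def IsPositiveSet (κ : Kernel α α) (A : Set α) : Prop :=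
  MeasurableSet A ∧ ∃ φ : Measure α, IsIrreducibilityMeasure κ φ ∧ 0 < φ A

/-- `D` is a `d`-cycle of `κ`: the sets `D i` (`i` modulo `d`) are measurable and disjoint, the
chain moves from `D i` to `D (i + 1)` with probability one, and the complement of their union is
null for a maximal irreducibility measure. -/
structure IsCycle (κ : Kernel α α) {d : ℕ} (D : ZMod d → Set α) : Prop where
  measurableSet : ∀ i, MeasurableSet (D i)
  disjoint : Pairwise fun i j => Disjoint (D i) (D j)
  move : ∀ i, ∀ x ∈ D i, κ x (D (i + 1)) = 1
  null : ¬ IsPositiveSet κ (⋃ i, D i)ᶜ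

/-- Harris ergodicity of a Markov transition kernel: irreducible, aperiodic, Harris recurrent. -/
structure IsHarrisErgodic (κ : Kernel α α) [IsMarkovKernel κ] : Prop where
  irreducible : ∃ φ : Measure α, IsIrreducibilityMeasure κ φ
  aperiodic : ∀ d : ℕ, 2 ≤ d → ∀ D : ZMod d → Set α, ¬ IsCycle κ D
  recurrent : ∀ A : Set α, IsPositiveSet κ A →
    ∀ x ∈ A, chainLaw κ x {w | ∃ᶠ n in atTop, w n ∈ A} = 1

variable {Ω : Type*}

/-- The tour made between the random times `τ r` and `τ (r + 1)`: its length together with the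
states visited at the times `τ r, …, τ (r + 1) - 1`. -/
def tour (θ : ℕ → Ω → α) (τ : ℕ → Ω → ℕ) (r : ℕ) (ω : Ω) : Σ n : ℕ, (Fin n → α) :=
  ⟨τ (r + 1) ω - τ r ω, fun k => θ (τ r ω + k) ω⟩

/-- Everything that happened before time `τ r`: the first `r` tours. -/
def past (θ : ℕ → Ω → α) (τ : ℕ → Ω → ℕ) (r : ℕ) (ω : Ω) : Fin r → Σ n : ℕ, (Fin n → α) :=
  fun s => tour θ τ s ω

/-- Everything that happens from time `τ r` on, with time counted from `τ r`: the states visited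
and the subsequent random times. -/
def future (θ : ℕ → Ω → α) (τ : ℕ → Ω → ℕ) (r : ℕ) (ω : Ω) : ℕ → α × ℕ :=
  fun k => (θ (τ r ω + k) ω, τ (r + k) ω - τ r ω)

/-- `τ 0 < τ 1 < ⋯` is a regeneration sequence of the process `θ`: `τ 0` is the initial time, and
at each time `τ r` the process restarts itself probabilistically, i.e. the future from `τ r` on is
independent of the past before `τ r` and has the same law as the original process. -/
structure IsRegenerationSequence [MeasurableSpace Ω] (μ : Measure Ω) (θ : ℕ → Ω → α)
    (τ : ℕ → Ω → ℕ) : Prop where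
  measurable : ∀ r, Measurable (τ r)
  start : ∀ᵐ ω ∂μ, τ 0 ω = 0
  strictMono : ∀ᵐ ω ∂μ, StrictMono fun r => τ r ω
  indepFun : ∀ r, IndepFun (past θ τ r) (future θ τ r) μ
  identDistrib : ∀ r, IdentDistrib (future θ τ r) (future θ τ 0) μ μ

/-- The sum of `g` over the tour between `τ r` and `τ (r + 1)`. -/
def tourSum (θ : ℕ → Ω → α) (τ : ℕ → Ω → ℕ) (g : α → ℝ) (r : ℕ) (ω : Ω) : ℝ :=
  ∑ i ∈ Finset.Ico (τ r ω) (τ (r + 1) ω), g (θ i ω)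

/-- The average `(1 / n) ∑ g (θ i)` over the first `n` states `θ 0, …, θ (n - 1)`. -/
def average (θ : ℕ → Ω → α) (g : α → ℝ) (n : ℕ) (ω : Ω) : ℝ :=
  (∑ i ∈ Finset.range n, g (θ i ω)) / n

end MarkovRegen

end

/-! Since `H` is compact, `h ↦ f h t` is for almost every `t` a point `G t` of the separable Banach
space `C(H, ℝ)`, and uniform convergence in `h` is norm convergence there. The tour sums of `G` are
pairwise independent and identically distributed, with integrable norm by the assumption on the
supremum. The Banach-valued strong law therefore applies, and dividing by the strong law for the
tour lengths gives a limit along the regeneration times (`tendsto_average_time`).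

The limit is identified through the occupation measure of one tour. It is invariant
(`invariant_occupation`), and an irreducible kernel has only one invariant measure of given finite
mass (`Invariant.unique`), so it equals the mean tour length times `P`. It also dominates the law of
every `θ n`, so the chain almost surely avoids the `P`-null set where continuity fails, whatever the
initial law.

Between regeneration times, a partial tour sum is bounded by the norm of the tour sum of `|G|`,
which is `o(R)` when that norm is integrable (`tendsto_average_of_blocks`). -/

namespace MarkovRegen

/-! ### Cesàro averages along blocks -/

section Deterministic

/-- A strictly increasing sequence starting at `0` cuts `ℕ` into consecutive blocks. -/
lemma exists_mem_block {t : ℕ → ℕ} (ht : StrictMono t) (h0 : t 0 = 0) (n : ℕ) :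
    ∃ r, t r ≤ n ∧ n < t (r + 1) := by
  induction n with
  | zero => exact ⟨0, h0.le, by simpa [h0] using ht zero_lt_one⟩
  | succ n ih =>
    obtain ⟨r, h1, h2⟩ := ih
    rcases (Nat.succ_le_of_lt h2).lt_or_eq with h | h
    · exact ⟨r, by omega, h⟩
    · exact ⟨r + 1, by omega, h.trans_lt (ht (Nat.lt_succ_self (r + 1)))⟩

/-- If Cesàro averages converge, then the terms are negligible with respect to the index. -/
lemma tendsto_inv_smul_of_tendsto_average {E : Type*} [NormedAddCommGroup E] [NormedSpace ℝ E]
    {x : ℕ → E} {L : E}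
    (h : Tendsto (fun n : ℕ => (n : ℝ)⁻¹ • ∑ i ∈ Finset.range n, x i) atTop (𝓝 L)) :
    Tendsto (fun n : ℕ => (n : ℝ)⁻¹ • x n) atTop (𝓝 0) := by
  have h1 := (tendsto_add_atTop_iff_nat 1).2 h
  have hq : Tendsto (fun n : ℕ => ((n + 1 : ℕ) : ℝ) / n) atTop (𝓝 1) := by
    have : Tendsto (fun n : ℕ => 1 + (n : ℝ)⁻¹) atTop (𝓝 (1 + 0)) :=
      tendsto_const_nhds.add tendsto_inv_atTop_nhds_zero_nat
    rw [add_zero] at this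
    refine this.congr' ?_
    filter_upwards [eventually_gt_atTop 0] with n hn
    have : (n : ℝ) ≠ 0 := by positivity
    push_cast
    field_simp
  -- With `A n` the averages, `x n / n = ((n + 1) / n) A (n + 1) - A n`, and both terms tend to `L`.
  have h2 := (hq.smul h1).sub h
  rw [one_smul, sub_self] at h2
  refine h2.congr' ?_
  filter_upwards [eventually_gt_atTop 0] with n hn
  have hn' : (n : ℝ) ≠ 0 := by positivity
  have hn1 : ((n + 1 : ℕ) : ℝ) ≠ 0 := by positivity
  rw [smul_smul, div_mul_eq_mul_div, mul_inv_cancel₀ hn1, one_div, ← smul_sub,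
    Finset.sum_range_succ, add_sub_cancel_left]

/-- Convergence of averages along a sequence of times of linear growth extends to all times, when
the partial sums over the blocks are negligible. -/
lemma tendsto_average_of_blocks {E : Type*} [NormedAddCommGroup E] [NormedSpace ℝ E]
    {t : ℕ → ℕ} (ht : StrictMono t) (h0 : t 0 = 0) {m : ℝ} (hm : 0 < m)
    (htm : Tendsto (fun R : ℕ => (R : ℝ)⁻¹ * t R) atTop (𝓝 m))
    {S : ℕ → E} {L : E} (hS : Tendsto (fun R => (t R : ℝ)⁻¹ • S (t R)) atTop (𝓝 L))
    {W : ℕ → ℝ} (hW : Tendsto (fun R : ℕ => (R : ℝ)⁻¹ * W R) atTop (𝓝 0))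
    (hSW : ∀ R n, t R ≤ n → n < t (R + 1) → ‖S n - S (t R)‖ ≤ W R) :
    Tendsto (fun n : ℕ => (n : ℝ)⁻¹ • S n) atTop (𝓝 L) := by
  choose r hr1 hr2 using exists_mem_block ht h0
  have hr : Tendsto r atTop atTop := by
    refine tendsto_atTop.2 fun K => ?_
    filter_upwards [eventually_ge_atTop (t K)] with n hn
    by_contra! h
    exact absurd (hr2 n) (not_lt.2 ((ht.monotone h).trans hn))
  have hWt : Tendsto (fun R => W R / t R) atTop (𝓝 0) := by
    have := hW.div htm hm.ne'
    rw [zero_div] at this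
    refine this.congr' ?_
    filter_upwards [eventually_gt_atTop 0] with R hR
    have hR' : (R : ℝ) ≠ 0 := by positivity
    rw [Pi.div_apply, mul_div_mul_left _ _ (inv_ne_zero hR')]
  have hlen : Tendsto (fun R => ((t (R + 1) : ℝ) - t R) / t R) atTop (𝓝 0) := by
    have h1 : Tendsto (fun R : ℕ => (R : ℝ)⁻¹ • ∑ i ∈ Finset.range R, ((t (i + 1) : ℝ) - t i))
        atTop (𝓝 m) := by
      refine htm.congr fun R => ?_
      rw [Finset.sum_range_sub (fun i => (t i : ℝ)), h0, smul_eq_mul]; simp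
    have := (tendsto_inv_smul_of_tendsto_average h1).div htm hm.ne'
    rw [zero_div] at this
    refine this.congr' ?_
    filter_upwards [eventually_gt_atTop 0] with R hR
    have hR' : (R : ℝ) ≠ 0 := by positivity
    rw [Pi.div_apply, smul_eq_mul, mul_div_mul_left _ _ (inv_ne_zero hR')]
  have hbound : Tendsto (fun R => W R / t R + ‖(t R : ℝ)⁻¹ • S (t R) - L‖
      + ((t (R + 1) : ℝ) - t R) / t R * ‖L‖) atTop (𝓝 0) := by
    have := (hWt.add (tendsto_iff_norm_sub_tendsto_zero.1 hS)).add (hlen.mul_const ‖L‖)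
    simpa using this
  rw [tendsto_iff_norm_sub_tendsto_zero]
  refine squeeze_zero' (Eventually.of_forall fun _ => norm_nonneg _) ?_ (hbound.comp hr)
  -- From time `t 1` on, the block containing `n` starts at a positive time, so dividing by `t (r
  -- n)` is legitimate.
  filter_upwards [eventually_ge_atTop (t 1)] with n hn
  have ht1 : 0 < t 1 := h0 ▸ ht zero_lt_one
  have hr0 : 1 ≤ r n := by
    by_contra! h
    have : r n = 0 := by omega
    have h2 := hr2 n
    rw [this] at h2
    simp at h2; omega
  have htr : 0 < t (r n) := ht1.trans_le (ht.monotone hr0)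
  have htr' : (0 : ℝ) < t (r n) := by exact_mod_cast htr
  have hn0 : (0 : ℝ) < n := by exact_mod_cast ht1.trans_le hn
  have hle : (t (r n) : ℝ) ≤ n := by exact_mod_cast hr1 n
  have hlt : (n : ℝ) ≤ t (r n + 1) := by exact_mod_cast (hr2 n).le
  -- The error splits into the unfinished block, the error at the start of the block, and the change
  -- of normalization from `t (r n)` to `n`. These match the three terms of `hbound`.
  have key : (n : ℝ)⁻¹ • S n - L = (n : ℝ)⁻¹ • (S n - S (t (r n)))
      + ((n : ℝ)⁻¹ * t (r n)) • ((t (r n) : ℝ)⁻¹ • S (t (r n)) - L)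
      - ((n : ℝ)⁻¹ * (n - t (r n))) • L := by
    rw [smul_sub, smul_sub, smul_smul, mul_assoc, mul_inv_cancel₀ htr'.ne', mul_one, mul_sub,
      inv_mul_cancel₀ hn0.ne', sub_smul, one_smul]
    abel
  have hinv : (n : ℝ)⁻¹ ≤ (t (r n) : ℝ)⁻¹ := by gcongr
  have hW0 : 0 ≤ W (r n) := (norm_nonneg _).trans (hSW _ n (hr1 n) (hr2 n))
  rw [key]
  refine (norm_sub_le _ _).trans (add_le_add ((norm_add_le _ _).trans (add_le_add ?_ ?_)) ?_)
  · rw [norm_smul, Real.norm_of_nonneg (by positivity), div_eq_inv_mul]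
    exact mul_le_mul hinv (hSW _ n (hr1 n) (hr2 n)) (norm_nonneg _) (by positivity)
  · rw [norm_smul, Real.norm_of_nonneg (by positivity)]
    refine mul_le_of_le_one_left (norm_nonneg _) ?_
    rw [← div_eq_inv_mul]
    exact div_le_one_of_le₀ hle hn0.le
  · rw [norm_smul, Real.norm_of_nonneg (mul_nonneg (by positivity) (by linarith)), div_eq_inv_mul]
    gcongr

end Deterministic

/-! ### Uniqueness of the invariant measure -/

section Uniqueness

variable {α : Type*} [MeasurableSpace α]

lemma Invariant.comp_pow {κ : Kernel α α} {D : Measure α} (hD : Kernel.Invariant κ D) (n : ℕ) :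
    Kernel.Invariant (κ ^ n) D := by
  induction n with
  | zero => exact Measure.id_comp
  | succ n ih =>
    rw [pow_succ]
    exact Kernel.Invariant.comp ih hD

/-- An irreducibility measure is absolutely continuous with respect to every nonzero invariant
measure. -/
lemma absolutelyContinuous_of_invariant {κ : Kernel α α} {φ D : Measure α}
    (hφ : Kernel.IsIrreducible φ κ) (hD : Kernel.Invariant κ D) (hD0 : D ≠ 0) : φ ≪ D := by
  refine Measure.AbsolutelyContinuous.mk fun A hA hDA => ?_
  by_contra hne
  -- A `D`-null set stays null under every power of `κ`, so `D`-almost no state can ever reach it;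
  -- irreducibility forbids this if `φ A > 0`.
  have h : ∀ n : ℕ, ∀ᵐ x ∂D, (κ ^ n) x A = 0 := by
    intro n
    have h1 : ∫⁻ x, (κ ^ n) x A ∂D = 0 := by
      rw [← Measure.bind_apply hA (Kernel.aemeasurable _), (Invariant.comp_pow hD n).def, hDA]
    exact (lintegral_eq_zero_iff (Kernel.measurable_coe _ hA)).1 h1
  have : NeZero D := ⟨hD0⟩
  obtain ⟨x, hx⟩ := (ae_all_iff.2 h).exists
  obtain ⟨n, hn⟩ := hφ.irreducible hA (pos_iff_ne_zero.2 hne) x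
  exact hn.ne' (hx n)

/-- The positive part of the difference of two finite invariant measures is invariant. -/
lemma Invariant.sub {κ : Kernel α α} [IsMarkovKernel κ] {P Q : Measure α} [IsFiniteMeasure P]
    [IsFiniteMeasure Q] (hP : Kernel.Invariant κ P) (hQ : Kernel.Invariant κ Q) :
    Kernel.Invariant κ (P - Q) := by
  -- `P - Q` is the least measure which, added to `Q`, dominates `P`. Its image under `κ` also has
  -- this property, and the two masses agree because `κ` is Markov.
  have h : P - Q ≤ (P - Q).bind κ := by
    refine Measure.sub_le_of_le_add ?_
    calc P = P.bind κ := hP.def.symm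
      _ ≤ ((P - Q) + Q).bind κ := by
        refine Measure.le_iff.2 fun s hs => ?_
        rw [Measure.bind_apply hs (Kernel.aemeasurable _),
          Measure.bind_apply hs (Kernel.aemeasurable _)]
        exact lintegral_mono' (Measure.sub_le_iff_le_add.1 le_rfl) le_rfl
      _ = (P - Q).bind κ + Q := by rw [Measure.comp_add, hQ.def]
  refine (Measure.eq_of_le_of_measure_univ_eq h ?_).symm
  rw [Measure.bind_apply .univ (Kernel.aemeasurable _)]
  simp

/-- An irreducible Markov kernel has at most one finite invariant measure of given mass. -/
lemma Invariant.unique {κ : Kernel α α} [IsMarkovKernel κ] {φ P Q : Measure α} [IsFiniteMeasure P]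
    [IsFiniteMeasure Q] (hφ : Kernel.IsIrreducible φ κ) (hφ0 : φ ≠ 0)
    (hP : Kernel.Invariant κ P) (hQ : Kernel.Invariant κ Q) (huniv : P Set.univ = Q Set.univ) :
    P = Q := by
  by_contra hne
  have hpos : ∀ {A B : Measure α} [IsFiniteMeasure A] [IsFiniteMeasure B],
      A Set.univ = B Set.univ → A ≠ B → A - B ≠ 0 := by
    intro A B _ _ hu hAB h0
    have hle : A ≤ A - B + B := Measure.sub_le_iff_le_add.1 le_rfl
    rw [h0, zero_add] at hle
    exact hAB (Measure.eq_of_le_of_measure_univ_eq hle hu)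
  have h1 := absolutelyContinuous_of_invariant hφ (Invariant.sub hP hQ) (hpos huniv hne)
  have h2 := absolutelyContinuous_of_invariant hφ (Invariant.sub hQ hP)
    (hpos huniv.symm (Ne.symm hne))
  refine hφ0 ?_
  -- `P - Q` and `Q - P` are mutually singular, yet `φ` is absolutely continuous with respect to
  -- both.
  have hs : φ ⟂ₘ φ := (Measure.mutually_singular_measure_sub (μ := P) (ν := Q)).mono_ac h1 h2
  exact Measure.MutuallySingular.self_iff _ |>.1 hs

end Uniqueness

end MarkovRegen

namespace MarkovRegen

/-! ### Strong laws for tour sums -/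

section Tours

variable {α : Type*} {Ω : Type*} {E : Type*}

/-- The sum of the vector-valued function `G` over the tour between `τ r` and `τ (r + 1)`. -/
def blockSum [AddCommMonoid E] (θ : ℕ → Ω → α) (τ : ℕ → Ω → ℕ) (G : α → E) (r : ℕ) (ω : Ω) : E :=
  ∑ i ∈ Finset.Ico (τ r ω) (τ (r + 1) ω), G (θ i ω)

lemma sum_range_blockSum [AddCommMonoid E] {θ : ℕ → Ω → α} {τ : ℕ → Ω → ℕ} {ω : Ω} (G : α → E)
    (h0 : τ 0 ω = 0) (hmono : StrictMono fun r => τ r ω) (R : ℕ) :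
    ∑ r ∈ Finset.range R, blockSum θ τ G r ω = ∑ i ∈ Finset.range (τ R ω), G (θ i ω) := by
  induction R with
  | zero => simp [h0]
  | succ R ih =>
    rw [Finset.sum_range_succ, ih, blockSum, Finset.range_eq_Ico,
      Finset.sum_Ico_consecutive _ (Nat.zero_le _) (hmono.monotone (Nat.le_succ R)),
      Finset.range_eq_Ico]

lemma blockSum_eq_sum_tour [AddCommMonoid E] (θ : ℕ → Ω → α) (τ : ℕ → Ω → ℕ) (G : α → E) (r : ℕ) (ω : Ω) :
    blockSum θ τ G r ω = ∑ k, G ((tour θ τ r ω).2 k) := by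
  rw [blockSum, Finset.sum_Ico_eq_sum_range]
  exact Finset.sum_range _

/-- The coordinate `(w 1).2` of the future from `τ r` is `τ (r + 1) - τ r`, the length of the
current tour, so the future alone determines the block. -/
lemma blockSum_eq_sum_future [AddCommMonoid E] (θ : ℕ → Ω → α) (τ : ℕ → Ω → ℕ) (G : α → E) (r : ℕ) :
    blockSum θ τ G r =
      (fun w : ℕ → α × ℕ => ∑ k ∈ Finset.range (w 1).2, G (w k).1) ∘ future θ τ r := by
  funext ω
  rw [blockSum, Finset.sum_Ico_eq_sum_range]
  rfl

lemma blockSum_one {θ : ℕ → Ω → α} {τ : ℕ → Ω → ℕ} {ω : Ω}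
    (hmono : StrictMono fun r => τ r ω) (r : ℕ) :
    blockSum θ τ (fun _ => (1 : ℝ)) r ω = (τ (r + 1) ω : ℝ) - τ r ω := by
  simp [blockSum, Nat.cast_sub (hmono.monotone (Nat.le_succ r))]

variable [MeasurableSpace α] [MeasurableSpace Ω] [NormedAddCommGroup E] [MeasurableSpace E]
  [BorelSpace E] [SecondCountableTopology E]

/-- Measurability on the disjoint union is checked separately for each tour length. -/
lemma measurable_sum_sigma {G : α → E} (hG : Measurable G) :
    Measurable fun p : (Σ n : ℕ, (Fin n → α)) => ∑ k, G (p.2 k) := by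
  intro s hs
  refine MeasurableSpace.measurableSet_iInf.2 fun n => ?_
  have : Measurable fun x : Fin n → α => ∑ k, G (x k) :=
    Finset.measurable_sum _ fun k _ => hG.comp (measurable_pi_apply k)
  exact this hs

lemma measurable_sum_future {G : α → E} (hG : Measurable G) :
    Measurable fun w : ℕ → α × ℕ => ∑ k ∈ Finset.range (w 1).2, G (w k).1 := by
  have h : Measurable fun q : ℕ × (ℕ → α × ℕ) => ∑ k ∈ Finset.range q.1, G (q.2 k).1 :=
    measurable_from_prod_countable_right fun n =>
      Finset.measurable_sum (Finset.range n) fun k _ => hG.comp (measurable_pi_apply k).fst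
  exact h.comp ((measurable_pi_apply 1).snd.prodMk measurable_id)

variable {μ : Measure Ω} {θ : ℕ → Ω → α} {τ : ℕ → Ω → ℕ}

lemma IsRegenerationSequence.identDistrib_blockSum (hτ : IsRegenerationSequence μ θ τ) {G : α → E}
    (hG : Measurable G) (r : ℕ) : IdentDistrib (blockSum θ τ G r) (blockSum θ τ G 0) μ μ := by
  rw [blockSum_eq_sum_future, blockSum_eq_sum_future]
  exact (hτ.identDistrib r).comp (measurable_sum_future hG)

/-- Of two blocks, the earlier is a function of the past before the start of the later one, and the
later is a function of the future from there. Pairwise independence is all that the strong law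
requires. -/
lemma IsRegenerationSequence.indepFun_blockSum (hτ : IsRegenerationSequence μ θ τ) {G : α → E}
    (hG : Measurable G) : Pairwise (Function.onFun (IndepFun (μ := μ)) (blockSum θ τ G)) := by
  have h : ∀ {s r : ℕ}, s < r → IndepFun (blockSum θ τ G s) (blockSum θ τ G r) μ := by
    intro s r hsr
    rw [blockSum_eq_sum_future θ τ G r]
    have h1 : blockSum θ τ G s = (fun p : Fin r → Σ n : ℕ, (Fin n → α) =>
        ∑ k, G ((p ⟨s, hsr⟩).2 k)) ∘ past θ τ r := by
      funext ω
      exact blockSum_eq_sum_tour θ τ G s ω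
    rw [h1]
    exact (hτ.indepFun r).comp ((measurable_sum_sigma hG).comp (measurable_pi_apply _))
      (measurable_sum_future hG)
  intro s r hsr
  rcases hsr.lt_or_gt with h1 | h1
  · exact h h1
  · exact (h h1).symm

lemma IsRegenerationSequence.aemeasurable_blockSum (hτ : IsRegenerationSequence μ θ τ) {G : α → E}
    (hG : Measurable G) (r : ℕ) : AEMeasurable (blockSum θ τ G r) μ :=
  (hτ.identDistrib_blockSum hG r).aemeasurable_fst

variable [NormedSpace ℝ E] [CompleteSpace E]

/-- The strong law of large numbers for the sums over the tours. -/
lemma IsRegenerationSequence.tendsto_average_blockSum (hτ : IsRegenerationSequence μ θ τ)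
    {G : α → E} (hG : Measurable G) (hint : Integrable (blockSum θ τ G 0) μ) :
    ∀ᵐ ω ∂μ, Tendsto (fun R : ℕ => (R : ℝ)⁻¹ • ∑ r ∈ Finset.range R, blockSum θ τ G r ω)
      atTop (𝓝 (∫ ω, blockSum θ τ G 0 ω ∂μ)) :=
  strong_law_ae _ hint (hτ.indepFun_blockSum hG) (hτ.identDistrib_blockSum hG)

lemma IsRegenerationSequence.blockSum_one_ae_eq (hτ : IsRegenerationSequence μ θ τ) :
    blockSum θ τ (fun _ => (1 : ℝ)) 0 =ᵐ[μ] fun ω => (τ 1 ω : ℝ) - τ 0 ω := by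
  filter_upwards [hτ.strictMono] with ω hω
  exact blockSum_one hω 0

/-- The regeneration times grow linearly. -/
lemma IsRegenerationSequence.tendsto_time (hτ : IsRegenerationSequence μ θ τ)
    (hτint : Integrable (fun ω => (τ 1 ω : ℝ) - (τ 0 ω : ℝ)) μ) :
    ∀ᵐ ω ∂μ, Tendsto (fun R : ℕ => (R : ℝ)⁻¹ * τ R ω) atTop
      (𝓝 (∫ ω, ((τ 1 ω : ℝ) - τ 0 ω) ∂μ)) := by
  have h := hτ.tendsto_average_blockSum (G := fun _ => (1 : ℝ)) measurable_const
    (hτint.congr hτ.blockSum_one_ae_eq.symm)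
  rw [integral_congr_ae hτ.blockSum_one_ae_eq] at h
  filter_upwards [h, hτ.start, hτ.strictMono] with ω h1 h2 h3
  refine h1.congr fun R => ?_
  rw [sum_range_blockSum _ h2 h3]
  simp

lemma IsRegenerationSequence.mean_length_pos [IsProbabilityMeasure μ]
    (hτ : IsRegenerationSequence μ θ τ)
    (hτint : Integrable (fun ω => (τ 1 ω : ℝ) - (τ 0 ω : ℝ)) μ) :
    0 < ∫ ω, ((τ 1 ω : ℝ) - τ 0 ω) ∂μ := by
  have h : ∫ _, (1 : ℝ) ∂μ ≤ ∫ ω, ((τ 1 ω : ℝ) - τ 0 ω) ∂μ := by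
    refine integral_mono_ae (integrable_const _) hτint ?_
    filter_upwards [hτ.strictMono] with ω hω
    have : τ 0 ω + 1 ≤ τ 1 ω := hω zero_lt_one
    have : (τ 0 ω : ℝ) + 1 ≤ τ 1 ω := by exact_mod_cast this
    linarith
  simp at h
  linarith

variable [IsProbabilityMeasure μ]

/-- The ratio limit theorem along the regeneration times. -/
lemma IsRegenerationSequence.tendsto_average_time (hτ : IsRegenerationSequence μ θ τ)
    (hτint : Integrable (fun ω => (τ 1 ω : ℝ) - (τ 0 ω : ℝ)) μ)
    {G : α → E} (hG : Measurable G) (hint : Integrable (blockSum θ τ G 0) μ) :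
    ∀ᵐ ω ∂μ, Tendsto (fun R => (τ R ω : ℝ)⁻¹ • ∑ i ∈ Finset.range (τ R ω), G (θ i ω)) atTop
      (𝓝 ((∫ ω, ((τ 1 ω : ℝ) - τ 0 ω) ∂μ)⁻¹ • ∫ ω, blockSum θ τ G 0 ω ∂μ)) := by
  filter_upwards [hτ.tendsto_average_blockSum hG hint, hτ.tendsto_time hτint, hτ.start,
    hτ.strictMono] with ω h1 h2 h3 h4
  have h := (h2.inv₀ (hτ.mean_length_pos hτint).ne').smul h1
  refine h.congr' ?_
  filter_upwards [eventually_gt_atTop 0] with R hR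
  have hR' : (R : ℝ) ≠ 0 := by positivity
  rw [sum_range_blockSum _ h3 h4, smul_smul, mul_inv, inv_inv, mul_right_comm,
    mul_inv_cancel₀ hR', one_mul]

/-- The ratio limit theorem at all times, when the partial sums over the tours are negligible. -/
lemma IsRegenerationSequence.tendsto_average_of_negligible (hτ : IsRegenerationSequence μ θ τ)
    (hτint : Integrable (fun ω => (τ 1 ω : ℝ) - (τ 0 ω : ℝ)) μ)
    {G : α → E} (hG : Measurable G) (hint : Integrable (blockSum θ τ G 0) μ) {W : ℕ → Ω → ℝ}
    (hW : ∀ᵐ ω ∂μ, Tendsto (fun R : ℕ => (R : ℝ)⁻¹ * W R ω) atTop (𝓝 0))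
    (hGW : ∀ ω R n, n ≤ τ (R + 1) ω → ‖∑ i ∈ Finset.Ico (τ R ω) n, G (θ i ω)‖ ≤ W R ω) :
    ∀ᵐ ω ∂μ, Tendsto (fun n : ℕ => (n : ℝ)⁻¹ • ∑ i ∈ Finset.range n, G (θ i ω)) atTop
      (𝓝 ((∫ ω, ((τ 1 ω : ℝ) - τ 0 ω) ∂μ)⁻¹ • ∫ ω, blockSum θ τ G 0 ω ∂μ)) := by
  filter_upwards [hτ.tendsto_average_time hτint hG hint, hτ.tendsto_time hτint, hτ.start,
    hτ.strictMono, hW] with ω h1 h2 h3 h4 h5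
  refine tendsto_average_of_blocks h4 h3 (hτ.mean_length_pos hτint) h2 h1 h5 fun R n hn hn' => ?_
  rw [← Finset.sum_Ico_eq_sub _ hn]
  exact hGW ω R n hn'.le

/-- For bounded functions, `C` times the tour length dominates every partial sum and is integrable.
This case serves to identify the occupation measure. -/
lemma IsRegenerationSequence.tendsto_average_bounded (hτ : IsRegenerationSequence μ θ τ)
    (hτint : Integrable (fun ω => (τ 1 ω : ℝ) - (τ 0 ω : ℝ)) μ)
    {G : α → E} (hG : Measurable G) {C : ℝ} (hC : ∀ x, ‖G x‖ ≤ C)  :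
    ∀ᵐ ω ∂μ, Tendsto (fun n : ℕ => (n : ℝ)⁻¹ • ∑ i ∈ Finset.range n, G (θ i ω)) atTop
      (𝓝 ((∫ ω, ((τ 1 ω : ℝ) - τ 0 ω) ∂μ)⁻¹ • ∫ ω, blockSum θ τ G 0 ω ∂μ)) := by
  have hsum : ∀ (s : Finset ℕ) ω, ‖∑ i ∈ s, G (θ i ω)‖ ≤ ∑ _i ∈ s, C := fun s ω =>
    norm_sum_le_of_le _ fun i _ => hC _
  have hlen := hτint.congr hτ.blockSum_one_ae_eq.symm
  have hC' : ∀ r ω, blockSum θ τ (fun _ => (1 : ℝ)) r ω * C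
      = ∑ _i ∈ Finset.Ico (τ r ω) (τ (r + 1) ω), C := by
    intro r ω; simp [blockSum]
  have hint : Integrable (blockSum θ τ G 0) μ := by
    refine (hlen.mul_const C).mono' (hτ.aemeasurable_blockSum hG 0).aestronglyMeasurable
      (Eventually.of_forall fun ω => ?_)
    rw [hC']
    exact hsum _ ω
  refine hτ.tendsto_average_of_negligible hτint hG hint
    (W := fun R ω => blockSum θ τ (fun _ => (1 : ℝ)) R ω * C) ?_ ?_
  · filter_upwards [hτ.tendsto_average_blockSum (G := fun _ => (1 : ℝ)) measurable_const hlen]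
      with ω h
    have := (tendsto_inv_smul_of_tendsto_average h).mul_const C
    rw [zero_mul] at this
    exact this.congr fun R => by rw [smul_eq_mul, mul_assoc]
  · intro ω R n hn
    refine (hsum _ ω).trans ?_
    rw [hC']
    rcases (Finset.Ico (τ R ω) n).eq_empty_or_nonempty with h | ⟨i, -⟩
    · rw [h, Finset.sum_empty]
      exact Finset.sum_nonneg fun i _ => (norm_nonneg _).trans (hC (θ i ω))
    · exact Finset.sum_le_sum_of_subset_of_nonneg (Finset.Ico_subset_Ico_right hn)
        fun j _ _ => (norm_nonneg _).trans (hC (θ j ω))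

end Tours

end MarkovRegen

noncomputable section

namespace MarkovRegen

/-! ### The occupation measure of a tour -/

section Occupation

variable {α : Type*} {Ω : Type*} [MeasurableSpace α] [MeasurableSpace Ω]

/-- The occupation measure of the first tour: the expected number of visits before time `τ 1`. -/
def occupation (μ : Measure Ω) (θ : ℕ → Ω → α) (τ : ℕ → Ω → ℕ) : Measure α :=
  Measure.sum fun i => (μ.restrict {ω | i < τ 1 ω}).map (θ i)

variable {μ : Measure Ω} {θ : ℕ → Ω → α} {τ : ℕ → Ω → ℕ} {κ : Kernel α α} [IsMarkovKernel κ]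

lemma IsRegenerationSequence.measurableSet_lt_time (hτ : IsRegenerationSequence μ θ τ) (i : ℕ) :
    MeasurableSet {ω | i < τ 1 ω} :=
  measurableSet_lt measurable_const (hτ.measurable 1)

lemma tsum_indicator_lt {E : Type*} [AddCommMonoid E] [TopologicalSpace E] (g : ℕ → E) (n : ℕ) :
    ∑' i, (if i < n then g i else 0) = ∑ i ∈ Finset.range n, g i := by
  rw [tsum_eq_sum (s := Finset.range n) fun i hi => if_neg (by simpa using hi)]
  exact Finset.sum_congr rfl fun i hi => if_pos (Finset.mem_range.1 hi)

lemma lintegral_occupation (hθ : ∀ n, Measurable (θ n)) (hτ : IsRegenerationSequence μ θ τ)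
    {g : α → ℝ≥0∞} (hg : Measurable g) :
    ∫⁻ x, g x ∂(occupation μ θ τ) = ∫⁻ ω, ∑ i ∈ Finset.range (τ 1 ω), g (θ i ω) ∂μ := by
  rw [occupation, lintegral_sum_measure]
  simp_rw [← tsum_indicator_lt]
  rw [lintegral_tsum]
  · refine tsum_congr fun i => ?_
    rw [lintegral_map hg (hθ i), ← lintegral_indicator (hτ.measurableSet_lt_time i)]
    simp only [Set.indicator_apply, Set.mem_ofPred_eq]
  · exact fun i => (Measurable.ite (hτ.measurableSet_lt_time i) (hg.comp (hθ i))
      measurable_const).aemeasurable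

lemma occupation_univ (hθ : ∀ n, Measurable (θ n)) (hτ : IsRegenerationSequence μ θ τ)
    (hτint : Integrable (fun ω => (τ 1 ω : ℝ) - (τ 0 ω : ℝ)) μ) :
    occupation μ θ τ Set.univ = ENNReal.ofReal (∫ ω, ((τ 1 ω : ℝ) - τ 0 ω) ∂μ) := by
  have h : (fun ω => (τ 1 ω : ℝ) - τ 0 ω) =ᵐ[μ] fun ω => (τ 1 ω : ℝ) := by
    filter_upwards [hτ.start] with ω hω
    simp [hω]
  rw [← lintegral_one, lintegral_occupation hθ hτ measurable_const, integral_congr_ae h,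
    ofReal_integral_eq_lintegral_ofReal (hτint.congr h) (Eventually.of_forall fun _ => by positivity)]
  simp

lemma isFiniteMeasure_occupation (hθ : ∀ n, Measurable (θ n)) (hτ : IsRegenerationSequence μ θ τ)
    (hτint : Integrable (fun ω => (τ 1 ω : ℝ) - (τ 0 ω : ℝ)) μ) :
    IsFiniteMeasure (occupation μ θ τ) :=
  ⟨by rw [occupation_univ hθ hτ hτint]; exact ENNReal.ofReal_lt_top⟩

lemma integral_occupation (hθ : ∀ n, Measurable (θ n)) (hτ : IsRegenerationSequence μ θ τ)
    {g : α → ℝ} (hg : Measurable g) (hint : Integrable g (occupation μ θ τ)) :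
    ∫ x, g x ∂(occupation μ θ τ) = ∫ ω, blockSum θ τ g 0 ω ∂μ := by
  have h : blockSum θ τ g 0 =ᵐ[μ] fun ω => ∑' i, (if i < τ 1 ω then g (θ i ω) else 0) := by
    filter_upwards [hτ.start] with ω hω
    rw [tsum_indicator_lt, blockSum, hω, Finset.range_eq_Ico]
  have hm : ∀ i, Measurable fun ω => if i < τ 1 ω then g (θ i ω) else 0 := fun i =>
    Measurable.ite (hτ.measurableSet_lt_time i) (hg.comp (hθ i)) measurable_const
  rw [integral_congr_ae h, integral_tsum fun i => (hm i).aestronglyMeasurable, occupation,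
    integral_sum_measure hint]
  · refine tsum_congr fun i => ?_
    rw [integral_map (hθ i).aemeasurable hg.aestronglyMeasurable,
      ← integral_indicator (hτ.measurableSet_lt_time i)]
    simp only [Set.indicator_apply, Set.mem_ofPred_eq]
  -- The `L¹` norms of the terms add up to the integral of `|g|` against the occupation measure; its
  -- finiteness justifies exchanging sum and expectation.
  · have h2 : ∀ i, ∫⁻ ω, ‖(if i < τ 1 ω then g (θ i ω) else 0 : ℝ)‖ₑ ∂μ
        = ∫⁻ x, ‖g x‖ₑ ∂((μ.restrict {ω | i < τ 1 ω}).map (θ i)) := by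
      intro i
      rw [lintegral_map hg.enorm (hθ i), ← lintegral_indicator (hτ.measurableSet_lt_time i)]
      refine lintegral_congr fun ω => ?_
      by_cases hi : i < τ 1 ω <;> simp [hi]
    simp_rw [h2]
    rw [← lintegral_sum_measure]
    exact hint.2.ne

/-- The law of the next state is obtained by applying the transition kernel. -/
lemma IsMarkovChain.map_succ [IsProbabilityMeasure μ] (hθ : IsMarkovChain μ κ θ) (n : ℕ) :
    μ.map (θ (n + 1)) = (μ.map (θ n)).bind κ := by
  have hX : Measurable fun ω (i : Finset.Iic n) => θ i ω :=
    measurable_pi_lambda _ fun i => hθ.measurable i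
  have h := (hθ.hasCondDistrib n).map_eq
  have h1 : μ.map (θ (n + 1)) = (μ.map fun ω (i : Finset.Iic n) => θ i ω).bind (step κ n) := by
    have : IsProbabilityMeasure (μ.map fun ω (i : Finset.Iic n) => θ i ω) :=
      Measure.isProbabilityMeasure_map hX.aemeasurable
    rw [← Measure.snd_compProd, ← h, Measure.snd_map_prodMk hX]
  ext A hA
  rw [h1, Measure.bind_apply hA (Kernel.aemeasurable _),
    Measure.bind_apply hA (Kernel.aemeasurable _), lintegral_map (Kernel.measurable_coe _ hA) hX,
    lintegral_map (Kernel.measurable_coe _ hA) (hθ.measurable n)]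
  rfl

variable [IsProbabilityMeasure μ]

/-- The averages of the expectations of a bounded function converge to its integral with respect
to the normalized occupation measure. -/
lemma tendsto_average_integral (hθ : ∀ n, Measurable (θ n)) (hτ : IsRegenerationSequence μ θ τ)
    (hτint : Integrable (fun ω => (τ 1 ω : ℝ) - (τ 0 ω : ℝ)) μ)
    {g : α → ℝ} (hg : Measurable g) {C : ℝ} (hC : ∀ x, ‖g x‖ ≤ C) :
    Tendsto (fun n : ℕ => (n : ℝ)⁻¹ • ∑ i ∈ Finset.range n, ∫ ω, g (θ i ω) ∂μ) atTop
      (𝓝 ((∫ ω, ((τ 1 ω : ℝ) - τ 0 ω) ∂μ)⁻¹ • ∫ x, g x ∂(occupation μ θ τ))) := by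
  have := isFiniteMeasure_occupation hθ hτ hτint
  have hgi : Integrable g (occupation μ θ τ) :=
    Integrable.of_bound hg.aestronglyMeasurable C (Eventually.of_forall hC)
  have hi : ∀ i, Integrable (fun ω => g (θ i ω)) μ := fun i =>
    Integrable.of_bound (hg.comp (hθ i)).aestronglyMeasurable C (Eventually.of_forall fun _ => hC _)
  have h := tendsto_integral_of_dominated_convergence (μ := μ)
    (F := fun (n : ℕ) ω => (n : ℝ)⁻¹ • ∑ i ∈ Finset.range n, g (θ i ω))
    (f := fun _ => (∫ ω, ((τ 1 ω : ℝ) - τ 0 ω) ∂μ)⁻¹ • ∫ ω, blockSum θ τ g 0 ω ∂μ)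
    (fun _ => C) (fun n => ?_) (integrable_const _) (fun n => Eventually.of_forall fun ω => ?_)
    (hτ.tendsto_average_bounded hτint hg hC)
  · rw [integral_const, probReal_univ, one_smul, ← integral_occupation hθ hτ hg hgi] at h
    refine h.congr fun n => ?_
    rw [integral_smul, integral_finsetSum _ fun i _ => hi i]
  · have : Measurable fun ω => ∑ i ∈ Finset.range n, g (θ i ω) :=
      Finset.measurable_sum _ fun i _ => hg.comp (hθ i)
    exact (this.const_smul (n : ℝ)⁻¹).aestronglyMeasurable
  · rw [norm_smul, norm_inv, Real.norm_natCast]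
    have h1 : ‖∑ i ∈ Finset.range n, g (θ i ω)‖ ≤ n * C := by
      simpa using norm_sum_le_of_le (Finset.range n) fun i _ => hC (θ i ω)
    rcases n.eq_zero_or_pos with rfl | hn
    · simpa using (norm_nonneg _).trans (hC (θ 0 ω))
    · have : (0 : ℝ) < n := by exact_mod_cast hn
      rwa [inv_mul_le_iff₀ this]

/-- The occupation measure of a tour is invariant. -/
lemma invariant_occupation (hθ : IsMarkovChain μ κ θ) (hτ : IsRegenerationSequence μ θ τ)
    (hτint : Integrable (fun ω => (τ 1 ω : ℝ) - (τ 0 ω : ℝ)) μ) :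
    Kernel.Invariant κ (occupation μ θ τ) := by
  have := isFiniteMeasure_occupation hθ.measurable hτ hτint
  ext A hA
  have hκA := Kernel.measurable_coe κ hA
  rw [Measure.bind_apply hA (Kernel.aemeasurable _)]
  -- The times `τ r` are not assumed to be stopping times, so invariance is obtained from long-run
  -- averages. The averages of `P(θ i ∈ A)` and of `E κ(θ i, A)` converge to the integrals of `g`
  -- and of `κ · A` against the normalized occupation measure. By the Markov property the second
  -- sequence is the first with `i` shifted by one, which does not change the limit.
  set g : α → ℝ := A.indicator fun _ => 1 with hg_def
  have hg : Measurable g := measurable_const.indicator hA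
  have hgC : ∀ x, ‖g x‖ ≤ 1 := fun x => by
    by_cases hx : x ∈ A <;> simp [hg_def, hx]
  have hg' : Measurable fun x => (κ x A).toReal := hκA.ennreal_toReal
  have hgC' : ∀ x, ‖(κ x A).toReal‖ ≤ 1 := fun x => by
    rw [Real.norm_of_nonneg ENNReal.toReal_nonneg]
    exact ENNReal.toReal_le_of_le_ofReal zero_le_one (by simpa using prob_le_one)
  have hstep : ∀ i, ∫ ω, (κ (θ i ω) A).toReal ∂μ = ∫ ω, g (θ (i + 1) ω) ∂μ := by
    intro i
    have h1 : ∫ ω, g (θ (i + 1) ω) ∂μ = (μ.map (θ (i + 1))).real A := by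
      rw [← integral_map (hθ.measurable _).aemeasurable hg.aestronglyMeasurable, hg_def,
        integral_indicator_const _ hA, smul_eq_mul, mul_one]
    rw [h1, integral_toReal (f := fun ω => κ (θ i ω) A) (hκA.comp (hθ.measurable i)).aemeasurable
      (Eventually.of_forall fun _ => measure_lt_top _ _), Measure.real, hθ.map_succ,
      Measure.bind_apply hA (Kernel.aemeasurable _), lintegral_map hκA (hθ.measurable i)]
  have hm := hτ.mean_length_pos hτint
  have h1 := tendsto_average_integral hθ.measurable hτ hτint hg hgC
  have h2 := tendsto_average_integral hθ.measurable hτ hτint hg' hgC'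
  simp_rw [hstep] at h2
  have h3 : Tendsto (fun n : ℕ => (n : ℝ)⁻¹ • ∑ i ∈ Finset.range n, ∫ ω, g (θ (i + 1) ω) ∂μ) atTop
      (𝓝 ((∫ ω, ((τ 1 ω : ℝ) - τ 0 ω) ∂μ)⁻¹ • ∫ x, g x ∂(occupation μ θ τ))) := by
    have h0 : Tendsto (fun n : ℕ => (n : ℝ)⁻¹ • ∫ ω, g (θ 0 ω) ∂μ) atTop (𝓝 0) := by
      have := (tendsto_inv_atTop_nhds_zero_nat (𝕜 := ℝ)).smul_const (∫ ω, g (θ 0 ω) ∂μ)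
      rwa [zero_smul] at this
    have h := (h1.add (tendsto_inv_smul_of_tendsto_average h1)).sub h0
    rw [add_zero, sub_zero] at h
    refine h.congr fun n => ?_
    rw [← smul_add, ← smul_sub, ← Finset.sum_range_succ, Finset.sum_range_succ',
      add_sub_cancel_right]
  have h4 := smul_right_injective ℝ (inv_ne_zero hm.ne') (tendsto_nhds_unique h2 h3)
  rw [integral_toReal hκA.aemeasurable (Eventually.of_forall fun _ => measure_lt_top _ _), hg_def,
    integral_indicator_const _ hA, smul_eq_mul, mul_one, Measure.real,
    ENNReal.toReal_eq_toReal_iff' _ (measure_ne_top _ _)] at h4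
  · exact h4
  · refine ((lintegral_mono fun x => (prob_le_one : κ x A ≤ 1)).trans_lt ?_).ne
    simp

/-- The occupation measure of a tour is the invariant distribution times the mean tour length. -/
lemma occupation_eq_smul {P : Measure α} [IsProbabilityMeasure P] {φ : Measure α}
    (hφ : Kernel.IsIrreducible φ κ) (hφ0 : φ ≠ 0) (hP : Kernel.Invariant κ P)
    (hθ : IsMarkovChain μ κ θ) (hτ : IsRegenerationSequence μ θ τ)
    (hτint : Integrable (fun ω => (τ 1 ω : ℝ) - (τ 0 ω : ℝ)) μ) :
    occupation μ θ τ = ENNReal.ofReal (∫ ω, ((τ 1 ω : ℝ) - τ 0 ω) ∂μ) • P := by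
  have := isFiniteMeasure_occupation hθ.measurable hτ hτint
  have : IsFiniteMeasure (ENNReal.ofReal (∫ ω, ((τ 1 ω : ℝ) - τ 0 ω) ∂μ) • P) :=
    P.smul_finite ENNReal.ofReal_ne_top
  refine Invariant.unique hφ hφ0 (invariant_occupation hθ hτ hτint) ?_ ?_
  · rw [Kernel.Invariant, Measure.bind_smul, hP.def]
  · rw [occupation_univ hθ.measurable hτ hτint]
    simp

/-- The laws of the states are absolutely continuous with respect to the occupation measure. -/
lemma map_absolutelyContinuous_occupation (hθ : IsMarkovChain μ κ θ) (hτ : IsRegenerationSequence μ θ τ)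
    (hτint : Integrable (fun ω => (τ 1 ω : ℝ) - (τ 0 ω : ℝ)) μ) (n : ℕ) :
    μ.map (θ n) ≪ occupation μ θ τ := by
  induction n with
  | zero =>
    -- Since `τ 1 > 0` almost surely, the term `i = 0` of the occupation measure is the initial law
    -- itself.
    have h : μ.restrict {ω | 0 < τ 1 ω} = μ := by
      refine Measure.restrict_eq_self_of_ae_mem ?_
      filter_upwards [hτ.strictMono] with ω hω
      exact (Nat.zero_le _).trans_lt (hω zero_lt_one)
    have h1 := Measure.le_sum (fun i => (μ.restrict {ω | i < τ 1 ω}).map (θ i)) 0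
    simp only [h] at h1
    exact Measure.absolutelyContinuous_of_le h1
  | succ n ih =>
    -- Applying `κ` to both sides preserves absolute continuity and fixes the occupation measure.
    rw [hθ.map_succ, ← (invariant_occupation hθ hτ hτint).def]
    exact ih.comp_right κ

end Occupation

end MarkovRegen

end

namespace MarkovRegen

/-! ### Random elements of `C(K, ℝ)` -/

section ContinuousFunctions

variable {K : Type*} [TopologicalSpace K] {α : Type*} [MeasurableSpace α]

/-- A map to a separable metric space is measurable if the preimages of closed balls are. -/
lemma measurable_of_closedBall {E : Type*} [PseudoMetricSpace E] [SecondCountableTopology E]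
    [MeasurableSpace E] [BorelSpace E] {F : α → E}
    (hF : ∀ x r, MeasurableSet (F ⁻¹' Metric.closedBall x r)) : Measurable F := by
  refine measurable_of_isOpen fun U hU => ?_
  have h : ∀ x : U, ∃ r, 0 < r ∧ Metric.closedBall (x : E) r ⊆ U := fun x =>
    Metric.nhds_basis_closedBall.mem_iff.1 (hU.mem_nhds x.2)
  choose r hr hrU using h
  -- By the Lindelöf property countably many of these balls cover `U`.
  obtain ⟨T, hT, hTU⟩ := TopologicalSpace.isOpen_iUnion_countable
    (fun x : U => Metric.ball (x : E) (r x)) fun _ => Metric.isOpen_ball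
  have hU' : U = ⋃ x ∈ T, Metric.closedBall (x : E) (r x) := by
    refine Set.Subset.antisymm (fun y hy => ?_) (Set.iUnion₂_subset fun x _ => hrU x)
    have : y ∈ ⋃ x : U, Metric.ball (x : E) (r x) :=
      Set.mem_iUnion.2 ⟨⟨y, hy⟩, Metric.mem_ball_self (hr _)⟩
    rw [← hTU] at this
    exact Set.iUnion₂_mono (fun x _ => Metric.ball_subset_closedBall) this
  rw [hU', Set.preimage_iUnion₂]
  exact MeasurableSet.biUnion hT fun x _ => hF _ _

section Norm

variable [CompactSpace K]

/-- Partial sums of continuous functions are dominated in norm by the full sum of their absolute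
values. -/
lemma norm_sum_le_norm_sum_abs {ι : Type*} (F : ι → C(K, ℝ)) {s t : Finset ι} (hst : s ⊆ t) :
    ‖∑ i ∈ s, F i‖ ≤ ‖∑ i ∈ t, |F i|‖ := by
  refine (ContinuousMap.norm_le _ (norm_nonneg _)).2 fun x => ?_
  refine le_trans ?_ ((le_abs_self _).trans ((∑ i ∈ t, |F i|).norm_coe_le_norm x))
  rw [ContinuousMap.sum_apply, ContinuousMap.sum_apply]
  simp only [ContinuousMap.abs_apply]
  exact (Finset.abs_sum_le_sum_abs _ _).trans
    (Finset.sum_le_sum_of_subset_of_nonneg hst fun _ _ _ => abs_nonneg _)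

/-- Converts the hypothesis on the supremum over `h` into integrability of the norm. Suprema in
`ℝ≥0∞` need no boundedness, and for empty `K` both sides vanish. -/
lemma enorm_le_iSup_enorm (F : C(K, ℝ)) : ‖F‖ₑ ≤ ⨆ x, ‖F x‖ₑ := by
  rcases eq_or_ne (⨆ x, ‖F x‖ₑ) ∞ with h | h
  · rw [h]; exact le_top
  rw [← ofReal_norm]
  refine ENNReal.ofReal_le_of_le_toReal ((ContinuousMap.norm_le _ ENNReal.toReal_nonneg).2 fun x => ?_)
  rw [← toReal_enorm]
  exact ENNReal.toReal_mono h (le_iSup (fun x => ‖F x‖ₑ) x)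

lemma iSup_enorm_le_enorm (F : C(K, ℝ)) : ⨆ x, ‖F x‖ₑ ≤ ‖F‖ₑ := by
  refine iSup_le fun x => ?_
  rw [← ofReal_norm, ← ofReal_norm]
  exact ENNReal.ofReal_le_ofReal (F.norm_coe_le_norm x)

end Norm

variable [CompactSpace K] [SecondCountableTopology K] [LocallyCompactSpace K]
  [MeasurableSpace C(K, ℝ)] [BorelSpace C(K, ℝ)]

/-- A map to a space of continuous functions is measurable if its evaluations are. -/
lemma measurable_of_eval {F : α → C(K, ℝ)}
    (hF : ∀ h, Measurable fun a => F a h) : Measurable F := by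
  refine measurable_of_closedBall fun g r => ?_
  rcases lt_or_ge r 0 with hr | hr
  · simp [Metric.closedBall_eq_empty.2 hr]
  obtain ⟨D, hD, hDd⟩ := TopologicalSpace.exists_countable_dense K
  -- By continuity, a uniform bound `≤ r` need only be tested on a countable dense set.
  have h : F ⁻¹' Metric.closedBall g r = ⋂ h ∈ D, {a | dist (F a h) (g h) ≤ r} := by
    ext a
    simp only [Set.mem_preimage, Metric.mem_closedBall, Set.mem_iInter, Set.mem_ofPred_eq]
    rw [ContinuousMap.dist_le hr]
    refine ⟨fun h x _ => h x, fun h x => ?_⟩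
    have hc : IsClosed {x | dist (F a x) (g x) ≤ r} :=
      isClosed_le ((F a).continuous.dist g.continuous) continuous_const
    have : closure D ⊆ {x | dist (F a x) (g x) ≤ r} := hc.closure_subset_iff.2 h
    exact this (hDd x)
  rw [h]
  exact MeasurableSet.biInter hD fun h _ =>
    measurableSet_le ((hF h).dist measurable_const) measurable_const

/-- A family of measurable functions depending continuously on the parameter almost everywhere
agrees almost everywhere with a measurable map to a space of continuous functions. -/
lemma exists_measurable_continuousMap {P : Measure α} {f : K → α → ℝ}
    (hf : ∀ h, Measurable (f h)) (hfc : ∀ᵐ t ∂P, Continuous fun h => f h t) :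
    ∃ G : α → C(K, ℝ), Measurable G ∧ ∀ᵐ t ∂P, ∀ h, G t h = f h t := by
  classical
  -- Discontinuity may occur on a nonmeasurable set, so it is enlarged to a measurable null set, on
  -- which `G` is set to `0`.
  obtain ⟨N, hN, hNm, hN0⟩ := exists_measurable_superset_of_null (ae_iff.1 hfc)
  have hc : ∀ t, t ∉ N → Continuous fun h => f h t := fun t ht => by
    by_contra h
    exact ht (hN h)
  refine ⟨fun t => if ht : t ∈ N then 0 else ⟨fun h => f h t, hc t ht⟩,
    measurable_of_eval fun h => ?_, ?_⟩
  · have : (fun t => (if ht : t ∈ N then 0 else ⟨fun h => f h t, hc t ht⟩ : C(K, ℝ)) h)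
        = fun t => if t ∈ N then 0 else f h t := by
      funext t
      by_cases ht : t ∈ N <;> simp [ht]
    rw [this]
    exact Measurable.ite hNm measurable_const (hf h)
  · filter_upwards [compl_mem_ae_iff.2 hN0] with t ht h
    rw [dif_neg ht]
    rfl

end ContinuousFunctions

/-! ### Norm convergence as uniform convergence -/

section Uniform

variable {K : Type*} [TopologicalSpace K] {α Ω : Type*} {θ : ℕ → Ω → α} {τ : ℕ → Ω → ℕ}

lemma blockSum_apply (G : α → C(K, ℝ)) (r : ℕ) (ω : Ω) (h : K) :
    blockSum θ τ G r ω h = ∑ i ∈ Finset.Ico (τ r ω) (τ (r + 1) ω), G (θ i ω) h := by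
  rw [blockSum, ContinuousMap.sum_apply]

/-- Convergence of averages in the space of continuous functions is uniform convergence. -/
lemma tendsto_iSup_enorm_average [CompactSpace K] {G : α → C(K, ℝ)} {f : K → α → ℝ} {ω : Ω} {L : C(K, ℝ)}
    (hG : ∀ n h, G (θ n ω) h = f h (θ n ω)) {t : ℕ → ℕ}
    (h : Tendsto (fun n => (t n : ℝ)⁻¹ • ∑ i ∈ Finset.range (t n), G (θ i ω)) atTop (𝓝 L)) :
    Tendsto (fun n => ⨆ x, ‖average θ (f x) (t n) ω - L x‖ₑ) atTop (𝓝 0) := by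
  have h1 : Tendsto (fun n => ‖(t n : ℝ)⁻¹ • ∑ i ∈ Finset.range (t n), G (θ i ω) - L‖ₑ) atTop
      (𝓝 0) := by
    have := ENNReal.tendsto_ofReal (tendsto_iff_norm_sub_tendsto_zero.1 h)
    simpa only [ofReal_norm, ENNReal.ofReal_zero] using this
  refine tendsto_of_tendsto_of_tendsto_of_le_of_le tendsto_const_nhds h1 (fun _ => zero_le)
    fun n => le_trans (le_of_eq ?_) (iSup_enorm_le_enorm _)
  refine iSup_congr fun x => ?_
  rw [ContinuousMap.sub_apply, ContinuousMap.smul_apply, ContinuousMap.sum_apply, average,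
    smul_eq_mul, div_eq_inv_mul]
  simp_rw [hG]

end Uniform

end MarkovRegen

/-! ### The uniform ergodic theorem -/

theorem theorem3
    {d k : ℕ}
    (Θ : Set (EuclideanSpace ℝ (Fin d))) (hΘ : MeasurableSet Θ)
    (H : Set (EuclideanSpace ℝ (Fin k))) (hHconv : Convex ℝ H) (hHcomp : IsCompact H)
    -- the invariant distribution and the Harris ergodic transition kernel
    (P : Measure Θ) [IsProbabilityMeasure P]
    (κ : Kernel Θ Θ) [IsMarkovKernel κ] (hκ : MarkovRegen.IsHarrisErgodic κ)
    (hP : Kernel.Invariant κ P)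
    -- the functions
    (f : H → Θ → ℝ) (hfmeas : ∀ h, Measurable (f h)) (hfint : ∀ h, Integrable (f h) P)
    (hfcont : ∀ᵐ t ∂P, Continuous fun h => f h t)
    -- the chain and its regeneration sequence
    {Ω : Type*} [MeasurableSpace Ω] (μ : Measure Ω) [IsProbabilityMeasure μ]
    (θ : ℕ → Ω → Θ) (hθ : MarkovRegen.IsMarkovChain μ κ θ)
    (τ : ℕ → Ω → ℕ) (hτ : MarkovRegen.IsRegenerationSequence μ θ τ)
    (hτint : Integrable (fun ω => (τ 1 ω : ℝ) - (τ 0 ω : ℝ)) μ)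
    -- the supremum over `h` of the sums over the first tour
    (hSmeas : AEMeasurable (fun ω => ⨆ h : H, ‖MarkovRegen.tourSum θ τ (f h) 0 ω‖ₑ) μ)
    (hSint : ∫⁻ ω, ⨆ h : H, ‖MarkovRegen.tourSum θ τ (f h) 0 ω‖ₑ ∂μ < ∞) :
    -- the chain is run for `R` regenerations, that is for `n = τ R` steps, and `R → ∞`
    (∀ᵐ ω ∂μ, Tendsto
      (fun R : ℕ => ⨆ h : H, ‖MarkovRegen.average θ (f h) (τ R ω) ω - ∫ t, f h t ∂P‖ₑ)
      atTop (𝓝 0)) ∧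
    -- if the tour sums of `|f h|` satisfy the same condition (nothing new when `0 ≤ f h`), the
    -- number of steps `n` may run through all natural numbers
    (∫⁻ ω, ⨆ h : H, ‖MarkovRegen.tourSum θ τ (fun t => |f h t|) 0 ω‖ₑ ∂μ < ∞ →
      ∀ᵐ ω ∂μ, Tendsto
        (fun n : ℕ => ⨆ h : H, ‖MarkovRegen.average θ (f h) n ω - ∫ t, f h t ∂P‖ₑ)
        atTop (𝓝 0)) := by
  have : CompactSpace H := isCompact_iff_compactSpace.1 hHcomp
  let _ : MeasurableSpace C(H, ℝ) := borel _
  have : BorelSpace C(H, ℝ) := ⟨rfl⟩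
  obtain ⟨φ, hφ⟩ := hκ.irreducible
  obtain ⟨-, hφ0, hφ⟩ := hφ
  have hocc := MarkovRegen.occupation_eq_smul hφ hφ0 hP hθ hτ hτint
  have hm := hτ.mean_length_pos hτint
  set m := ∫ ω, ((τ 1 ω : ℝ) - τ 0 ω) ∂μ with hm_def
  obtain ⟨G, hG, hGf⟩ := MarkovRegen.exists_measurable_continuousMap hfmeas hfcont
  -- The law of each `θ n` is absolutely continuous with respect to the occupation measure, a
  -- multiple of `P`, so the exceptional `P`-null set of `G` is almost surely never visited.
  have hGθ : ∀ᵐ ω ∂μ, ∀ n h, G (θ n ω) h = f h (θ n ω) := by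
    rw [ae_all_iff]
    intro n
    refine ae_of_ae_map (hθ.measurable n).aemeasurable (p := fun t => ∀ h, G t h = f h t) ?_
    refine (MarkovRegen.map_absolutelyContinuous_occupation hθ hτ hτint n).ae_le ?_
    rw [hocc]
    exact Measure.ae_smul_measure hGf _
  have hint : Integrable (MarkovRegen.blockSum θ τ G 0) μ := by
    refine ⟨(hτ.aemeasurable_blockSum hG 0).aestronglyMeasurable, ?_⟩
    refine lt_of_le_of_lt (lintegral_mono_ae ?_) hSint
    filter_upwards [hGθ] with ω hω
    refine (MarkovRegen.enorm_le_iSup_enorm _).trans (le_of_eq (iSup_congr fun h => ?_))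
    rw [MarkovRegen.blockSum_apply, MarkovRegen.tourSum]
    simp_rw [hω]
  -- Evaluation at `h` is a continuous linear functional and commutes with the Bochner integral; the
  -- occupation formula then gives `m * ∫ t, f h t ∂P` for the mean tour sum of `f h`.
  have hL : ∀ h, (m⁻¹ • ∫ ω, MarkovRegen.blockSum θ τ G 0 ω ∂μ) h = ∫ t, f h t ∂P := by
    intro h
    have h1 := ContinuousLinearMap.integral_comp_comm (ContinuousMap.evalCLM ℝ h) hint
    have h2 : ∫ ω, MarkovRegen.blockSum θ τ (f h) 0 ω ∂μ = m * ∫ t, f h t ∂P := by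
      rw [← MarkovRegen.integral_occupation hθ.measurable hτ (hfmeas h), hocc,
        integral_smul_measure, ENNReal.toReal_ofReal hm.le, smul_eq_mul]
      rw [hocc]
      exact (hfint h).smul_measure ENNReal.ofReal_ne_top
    have h3 : ∫ ω, ContinuousMap.evalCLM ℝ h (MarkovRegen.blockSum θ τ G 0 ω) ∂μ
        = ∫ ω, MarkovRegen.blockSum θ τ (f h) 0 ω ∂μ := by
      refine integral_congr_ae ?_
      filter_upwards [hGθ] with ω hω
      rw [ContinuousMap.evalCLM_apply, MarkovRegen.blockSum_apply, MarkovRegen.blockSum]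
      simp_rw [hω]
    rw [h3, h2, ContinuousMap.evalCLM_apply] at h1
    rw [ContinuousMap.smul_apply, ← h1, smul_eq_mul, inv_mul_cancel_left₀ hm.ne']
  refine ⟨?_, fun habs => ?_⟩
  · filter_upwards [hτ.tendsto_average_time hτint hG hint, hGθ] with ω h1 h2
    have := MarkovRegen.tendsto_iSup_enorm_average h2 h1
    simpa only [← hm_def, hL] using this
  · have hGabs : Measurable fun t => |G t| := MarkovRegen.measurable_of_eval fun h => by
      have : Measurable fun t => G t h := (ContinuousMap.evalCLM ℝ h).measurable.comp hG
      simpa only [ContinuousMap.abs_apply, Function.comp_def] using measurable_abs.comp this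
    have hint' : Integrable (MarkovRegen.blockSum θ τ (fun t => |G t|) 0) μ := by
      refine ⟨(hτ.aemeasurable_blockSum hGabs 0).aestronglyMeasurable, ?_⟩
      refine lt_of_le_of_lt (lintegral_mono_ae ?_) habs
      filter_upwards [hGθ] with ω hω
      refine (MarkovRegen.enorm_le_iSup_enorm _).trans (le_of_eq (iSup_congr fun h => ?_))
      rw [MarkovRegen.blockSum_apply, MarkovRegen.tourSum]
      simp_rw [ContinuousMap.abs_apply, hω]
    -- `W R` bounds all partial sums of tour `R`. It is `o(R)` because the tour sums of `|G|` obey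
    -- the strong law, whose terms are negligible with respect to their index.
    have hall := hτ.tendsto_average_of_negligible hτint hG hint
      (W := fun R ω => ‖MarkovRegen.blockSum θ τ (fun t => |G t|) R ω‖) ?_ ?_
    · filter_upwards [hall, hGθ] with ω h1 h2
      have := MarkovRegen.tendsto_iSup_enorm_average (t := id) h2 h1
      simpa only [← hm_def, hL, id_eq] using this
    · filter_upwards [hτ.tendsto_average_blockSum hGabs hint'] with ω h
      have := (MarkovRegen.tendsto_inv_smul_of_tendsto_average h).norm
      rw [norm_zero] at this
      refine this.congr fun R => ?_
      rw [norm_smul, norm_inv, Real.norm_natCast]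
    · exact fun ω R n hn => MarkovRegen.norm_sum_le_norm_sum_abs (fun i => G (θ i ω))
        (Finset.Ico_subset_Ico_right hn)
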